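/- Let $x_1,\dots,x_n$ ($n\ge 1$) be distinct points of $\mathbb{R}^d$ and let $\nu_n=\frac1n\sum_{i=1}^n\delta_{x_i}$ be their empirical measure. Let $\Omega\subset\mathbb{R}^d$ be a convex set with $\mathrm{vol}(\Omega)>0$, and let $\mu$ be a probability measure on $\mathbb{R}^d$ that is absolutely continuous with respect to Lebesgue measure, has finite expectation ($\int\|u\|\,d\mu(u)<\infty$), and has support $\overline{\Omega}$. For $h\in\mathbb{R}^n$ put $$\phi_h(u)=\max_{1\le i\le n}\{u\cdot x_i+h_i\},\qquad W_i(h)=\{u\in\Omega:\ \phi_h\text{ is differentiable at }u\text{ and }\nabla\phi_h(u)=x_i\},$$ $$E(h)=\int_\Omega\phi_h\,d\mu-\frac1n\sum_{i=1}^n h_i,\qquad H_0^{(n)}=\Big\{h\in\mathbb{R}^n:\ W_i(h)\neq\emptyset\text{ for all }i\text{ and }\sum_{i=1}^n h_i=0\Big\}.$$ A map $T$ is called a transport of $\mu$ onto $\nu_n$ if it is measurable and $T\#\mu=\nu_n$, and a monotone transport if moreover $T=\nabla\varphi$ $\mu$-almost everywhere for some function $\varphi$ that is convex on $\Omega$.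 Then: 1. For every $h\in\mathbb{R}^n$ the gradient $\nabla\phi_h$ is piecewise constant on $\Omega$: one has $W_i(h)=\{u\in\Omega: u\cdot x_j+h_j<u\cdot x_i+h_i\ \text{for all } j\ne i\}$, these sets are pairwise disjoint, and they cover $\Omega$ up to a Lebesgue null set. Moreover $\phi_h$ is $\mu$-integrable on $\Omega$, so $E(h)$ is finite. 2. There is $h^*\in\mathbb{R}^n$ that minimizes $E$ over $\mathbb{R}^n$ and for which $\nabla\phi_{h^*}$ is a monotone transport of $\mu$ onto $\nu_n$; this map minimizes the quadratic cost $\int\|u-T(u)\|^2\,d\mu(u)\in[0,\infty]$ among all transports $T$ of $\mu$ onto $\nu_n$. The vector $h^*$ is unique up to an additive constant: the minimizers of $E$ over $\mathbb{R}^n$ are exactly the vectors $h^*+(b,\dots,b)$ with $b\in\mathbb{R}$, and these are also exactly the $h\in\mathbb{R}^n$ for which $\nabla\phi_h$ is a monotone transport of $\mu$ onto $\nu_n$. 3. The set $H_0^{(n)}$ is convex and $E$ is strictly convex on it. -/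

import Mathlib

open MeasureTheory Set
open scoped ENNReal Gradient

noncomputable section

namespace DiscreteTransport

/-- The empirical measure `(1/n) ∑ δ_{x_i}` of the points `x_1, …, x_n`. -/
def empiricalMeasure {d n : ℕ} (x : Fin n → EuclideanSpace ℝ (Fin d)) :
    Measure (EuclideanSpace ℝ (Fin d)) :=
  (n : ℝ≥0∞)⁻¹ • ∑ i, Measure.dirac (x i)

/-- The piecewise linear potential `φ_h(u) = max_i (u · x_i + h_i)`. The index set is finite, so
(for `n ≥ 1`) the supremum is a maximum. The formula is used on the whole space. -/
def potential {d n : ℕ} (x : Fin n → EuclideanSpace ℝ (Fin d)) (h : Fin n → ℝ)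
    (u : EuclideanSpace ℝ (Fin d)) : ℝ :=
  ⨆ i, (inner ℝ u (x i) + h i)

/-- The cell `W_i(h)`: the points of `Ω` at which `φ_h` is differentiable with gradient `x_i`. -/
def cell {d n : ℕ} (Ω : Set (EuclideanSpace ℝ (Fin d))) (x : Fin n → EuclideanSpace ℝ (Fin d))
    (h : Fin n → ℝ) (i : Fin n) : Set (EuclideanSpace ℝ (Fin d)) :=
  {u | u ∈ Ω ∧ HasGradientAt (potential x h) (x i) u}

/-- The energy `E(h) = ∫_Ω φ_h dμ - (1/n) ∑ h_i`. -/
def energy {d n : ℕ} (Ω : Set (EuclideanSpace ℝ (Fin d)))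
    (μ : Measure (EuclideanSpace ℝ (Fin d))) (x : Fin n → EuclideanSpace ℝ (Fin d))
    (h : Fin n → ℝ) : ℝ :=
  (∫ u in Ω, potential x h u ∂μ) - (1 / (n : ℝ)) * ∑ i, h i

/-- The set `H_0^{(n)}` of the vectors with zero sum all of whose cells are non-empty. -/
def H₀ {d n : ℕ} (Ω : Set (EuclideanSpace ℝ (Fin d))) (x : Fin n → EuclideanSpace ℝ (Fin d)) :
    Set (Fin n → ℝ) :=
  {h | (∀ i, (cell Ω x h i).Nonempty) ∧ ∑ i, h i = 0}

/-- `T` is a monotone transport of `μ` (living on the convex set `Ω`) onto `ν`: it is measurable,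
pushes `μ` forward to `ν`, and is `μ`-almost everywhere the gradient of a function that is convex
on `Ω`. -/
def IsMonotoneTransport {d : ℕ} (Ω : Set (EuclideanSpace ℝ (Fin d)))
    (μ ν : Measure (EuclideanSpace ℝ (Fin d)))
    (T : EuclideanSpace ℝ (Fin d) → EuclideanSpace ℝ (Fin d)) : Prop :=
  MeasurePreserving T μ ν ∧
    ∃ φ : EuclideanSpace ℝ (Fin d) → ℝ, ConvexOn ℝ Ω φ ∧ ∀ᵐ u ∂μ, HasGradientAt φ (T u) u

/-- The quadratic cost `∫ ‖u - T u‖² dμ(u) ∈ [0, ∞]`. -/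
def quadraticCost {d : ℕ} (μ : Measure (EuclideanSpace ℝ (Fin d)))
    (T : EuclideanSpace ℝ (Fin d) → EuclideanSpace ℝ (Fin d)) : ℝ≥0∞ :=
  ∫⁻ u, ENNReal.ofReal (‖u - T u‖ ^ 2) ∂μ

/-- `T` is a transport of `μ` onto `ν` of minimal quadratic cost. -/
def IsQuadraticOptimal {d : ℕ} (μ ν : Measure (EuclideanSpace ℝ (Fin d)))
    (T : EuclideanSpace ℝ (Fin d) → EuclideanSpace ℝ (Fin d)) : Prop :=
  MeasurePreserving T μ ν ∧
    ∀ S : EuclideanSpace ℝ (Fin d) → EuclideanSpace ℝ (Fin d),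
      MeasurePreserving S μ ν → quadraticCost μ T ≤ quadraticCost μ S

end DiscreteTransport

end

/-! The energy is convex in `h`, and formally its `i`-th partial derivative is `μ(W_i(h)) - 1/n`.
Minimizers should therefore be exactly the weights whose cells all have mass `1/n`, that is, those
whose gradient is a transport. Both directions are proved without differentiating `E`. On `W_i(h)`
one has `φ_{h'} ≥ φ_h + (h'_i - h_i)`; integrating this shows that a transport minimizes
(`isMinOn_energy_of_measurePreserving`). Conversely, raising one weight of a minimizer by `t → 0`
gives every cell mass at least `1/n`, and the total mass 1 forces equality
(`measurePreserving_of_isMinOn_energy`).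

A minimizer exists because `E` ignores additive constants and its sublevel sets on the zero-sum
hyperplane are bounded. Uniqueness and strict convexity share one rigidity argument: equality in the
convexity inequality makes `φ_{h'} - φ_h` take finitely many values on the connected interior of
`Ω`, hence be constant there, and each nonempty cell then transfers this constant to its weight
(`eq_add_const_of_ae_common_cell`).

Quadratic optimality is pointwise: maximizing `u · x_i + h_i` is minimizing `‖u - x_i‖² - ‖x_i‖² - 2
h_i`, and the correction integrates to the same value for every transport. -/

open Filter Topology

namespace DiscreteTransport

/-! ### The max-affine potential and its cells -/

section Potential

variable {d n : ℕ} {x : Fin n → EuclideanSpace ℝ (Fin d)}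

lemma le_potential (x : Fin n → EuclideanSpace ℝ (Fin d)) (h : Fin n → ℝ)
    (u : EuclideanSpace ℝ (Fin d)) (i : Fin n) : inner ℝ u (x i) + h i ≤ potential x h u :=
  le_ciSup (f := fun i => inner ℝ u (x i) + h i) (Set.finite_range _).bddAbove i

lemma exists_eq_potential [Nonempty (Fin n)] (x : Fin n → EuclideanSpace ℝ (Fin d)) (h : Fin n → ℝ)
    (u : EuclideanSpace ℝ (Fin d)) : ∃ i, inner ℝ u (x i) + h i = potential x h u :=
  exists_eq_ciSup_of_finite

lemma potential_le [Nonempty (Fin n)] {h : Fin n → ℝ} {u : EuclideanSpace ℝ (Fin d)} {c : ℝ}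
    (hc : ∀ i, inner ℝ u (x i) + h i ≤ c) : potential x h u ≤ c :=
  ciSup_le hc

lemma potential_add_const [Nonempty (Fin n)]
    (h : Fin n → ℝ) (b : ℝ) (u : EuclideanSpace ℝ (Fin d)) :
    potential x (fun i => h i + b) u = potential x h u + b := by
  refine le_antisymm (potential_le fun i => ?_) ?_
  · linarith [le_potential x h u i]
  · obtain ⟨i, hi⟩ := exists_eq_potential x h u
    linarith [le_potential x (fun i => h i + b) u i]

lemma continuous_potential [Nonempty (Fin n)] (x : Fin n → EuclideanSpace ℝ (Fin d))
    (h : Fin n → ℝ) : Continuous (potential x h) := by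
  have : potential x h =
      fun u => Finset.univ.sup' Finset.univ_nonempty fun i => inner ℝ u (x i) + h i := by
    ext u
    rw [Finset.sup'_univ_eq_ciSup]
    rfl
  rw [this]
  exact Continuous.finset_sup'_apply _ fun i _ => by fun_prop

lemma convexOn_potential [Nonempty (Fin n)] (x : Fin n → EuclideanSpace ℝ (Fin d)) (h : Fin n → ℝ)
    {s : Set (EuclideanSpace ℝ (Fin d))} (hs : Convex ℝ s) : ConvexOn ℝ s (potential x h) := by
  refine ⟨hs, fun u _ v _ a b ha hb hab => potential_le fun i => ?_⟩
  have h1 := mul_le_mul_of_nonneg_left (le_potential x h u i) ha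
  have h2 := mul_le_mul_of_nonneg_left (le_potential x h v i) hb
  simp only [inner_add_left, real_inner_smul_left, smul_eq_mul]
  have : h i = a * h i + b * h i := by rw [← add_mul, hab, one_mul]
  linarith

lemma potential_combo_le [Nonempty (Fin n)]
    (h h' : Fin n → ℝ) (u : EuclideanSpace ℝ (Fin d)) {a b : ℝ}
    (ha : 0 ≤ a) (hb : 0 ≤ b) (hab : a + b = 1) :
    potential x (a • h + b • h') u ≤ a * potential x h u + b * potential x h' u := by
  refine potential_le fun i => ?_
  have h1 := mul_le_mul_of_nonneg_left (le_potential x h u i) ha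
  have h2 := mul_le_mul_of_nonneg_left (le_potential x h' u i) hb
  simp only [Pi.add_apply, Pi.smul_apply, smul_eq_mul]
  have : (inner ℝ u (x i) : ℝ) = a * inner ℝ u (x i) + b * inner ℝ u (x i) := by
    rw [← add_mul, hab, one_mul]
  linarith

/-- If the potential at a convex combination of weights is the combination of the potentials, then
a common index is maximal for both weights. -/
lemma exists_common_max_of_combo_eq [Nonempty (Fin n)]
    {h h' : Fin n → ℝ} {u : EuclideanSpace ℝ (Fin d)} {a b : ℝ}
    (ha : 0 < a) (hb : 0 < b) (hab : a + b = 1)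
    (heq : potential x (a • h + b • h') u = a * potential x h u + b * potential x h' u) :
    ∃ i, inner ℝ u (x i) + h i = potential x h u ∧ inner ℝ u (x i) + h' i = potential x h' u := by
  obtain ⟨i, hi⟩ := exists_eq_potential x (a • h + b • h') u
  simp only [Pi.add_apply, Pi.smul_apply, smul_eq_mul] at hi
  have h1 := le_potential x h u i
  have h2 := le_potential x h' u i
  have h3 : a * (potential x h u - (inner ℝ u (x i) + h i)) +
      b * (potential x h' u - (inner ℝ u (x i) + h' i)) = 0 := by
    have : (inner ℝ u (x i) : ℝ) = a * inner ℝ u (x i) + b * inner ℝ u (x i) := by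
      rw [← add_mul, hab, one_mul]
    linarith
  have h4 := mul_nonneg ha.le (sub_nonneg.2 h1)
  have h5 := mul_nonneg hb.le (sub_nonneg.2 h2)
  refine ⟨i, ?_, ?_⟩
  · have := (mul_eq_zero.1 (by linarith :
      a * (potential x h u - (inner ℝ u (x i) + h i)) = 0)).resolve_left ha.ne'
    linarith
  · have := (mul_eq_zero.1 (by linarith :
      b * (potential x h' u - (inner ℝ u (x i) + h' i)) = 0)).resolve_left hb.ne'
    linarith

lemma abs_potential_le [Nonempty (Fin n)] (h : Fin n → ℝ) (u : EuclideanSpace ℝ (Fin d)) :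
    |potential x h u| ≤ (∑ i, ‖x i‖) * ‖u‖ + ∑ i, |h i| := by
  obtain ⟨i, hi⟩ := exists_eq_potential x h u
  rw [← hi]
  have h1 : ‖x i‖ ≤ ∑ i, ‖x i‖ :=
    Finset.single_le_sum (f := fun i => ‖x i‖) (fun _ _ => norm_nonneg _) (Finset.mem_univ i)
  have h2 : |h i| ≤ ∑ i, |h i| :=
    Finset.single_le_sum (f := fun i => |h i|) (fun _ _ => abs_nonneg _) (Finset.mem_univ i)
  calc |inner ℝ u (x i) + h i| ≤ |inner ℝ u (x i)| + |h i| := abs_add_le _ _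
    _ ≤ ‖u‖ * ‖x i‖ + |h i| := by gcongr; exact abs_real_inner_le_norm _ _
    _ ≤ _ := by rw [mul_comm]; gcongr

/-- Subtracting an affine function that touches `φ_h` from below at `u` leaves a minimum at `u`, so
the derivatives agree there. -/
lemma eq_of_hasGradientAt_potential [Nonempty (Fin n)]
    {h : Fin n → ℝ} {u g : EuclideanSpace ℝ (Fin d)} {m : Fin n}
    (hg : HasGradientAt (potential x h) g u) (hm : inner ℝ u (x m) + h m = potential x h u) :
    x m = g := by
  have h1 : HasFDerivAt (fun v => potential x h v - InnerProductSpace.toDual ℝ _ (x m) v)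
      (InnerProductSpace.toDual ℝ _ g - InnerProductSpace.toDual ℝ _ (x m)) u :=
    hg.hasFDerivAt.sub (InnerProductSpace.toDual ℝ _ (x m)).hasFDerivAt
  have h2 : IsLocalMin (fun v => potential x h v - InnerProductSpace.toDual ℝ _ (x m) v) u := by
    refine Filter.Eventually.of_forall fun v => ?_
    have := le_potential x h v m
    simp only [InnerProductSpace.toDual_apply_apply]
    rw [real_inner_comm] at hm this
    linarith
  have h3 := sub_eq_zero.1 (h2.hasFDerivAt_eq_zero h1)
  exact ((InnerProductSpace.toDual ℝ _).injective h3).symm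

lemma hasGradientAt_potential [Nonempty (Fin n)]
    {h : Fin n → ℝ} {u : EuclideanSpace ℝ (Fin d)} {i : Fin n}
    (hi : ∀ j, j ≠ i → inner ℝ u (x j) + h j < inner ℝ u (x i) + h i) :
    HasGradientAt (potential x h) (x i) u := by
  have h1 : HasFDerivAt (fun v => InnerProductSpace.toDual ℝ _ (x i) v + h i)
      (InnerProductSpace.toDual ℝ _ (x i)) u :=
    (InnerProductSpace.toDual ℝ _ (x i)).hasFDerivAt.add_const _
  have h2 : ∀ᶠ v in 𝓝 u, ∀ j, j ≠ i → inner ℝ v (x j) + h j < inner ℝ v (x i) + h i := by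
    refine Filter.eventually_all.2 fun j => ?_
    by_cases hj : j = i
    · simp [hj]
    · filter_upwards [(continuous_id.inner continuous_const |>.add
        continuous_const).continuousAt.eventually_lt
        (continuous_id.inner continuous_const |>.add continuous_const).continuousAt (hi j hj)]
        with v hv _ using hv
  refine h1.congr_of_eventuallyEq ?_
  filter_upwards [h2] with v hv
  rw [InnerProductSpace.toDual_apply_apply, real_inner_comm]
  refine le_antisymm (potential_le fun j => ?_) (le_potential x h v i)
  by_cases hj : j = i
  · rw [hj]
  · exact (hv j hj).le

/-- At a point of differentiability every maximal index has the gradient as its slope; since the `x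
i` are distinct, a tie is impossible. -/
lemma mem_cell_iff [Nonempty (Fin n)]
    (hx : Function.Injective x) {Ω : Set (EuclideanSpace ℝ (Fin d))}
    {h : Fin n → ℝ} {i : Fin n} {u : EuclideanSpace ℝ (Fin d)} :
    u ∈ cell Ω x h i ↔
      u ∈ Ω ∧ ∀ j, j ≠ i → inner ℝ u (x j) + h j < inner ℝ u (x i) + h i := by
  refine ⟨fun hu => ⟨hu.1, fun j hj => ?_⟩, fun hu => ⟨hu.1, hasGradientAt_potential hu.2⟩⟩
  have key : ∀ m, inner ℝ u (x m) + h m = potential x h u → m = i := fun m hm =>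
    hx (eq_of_hasGradientAt_potential hu.2 hm)
  obtain ⟨m, hm⟩ := exists_eq_potential x h u
  obtain rfl := key m hm
  rw [hm]
  exact lt_of_le_of_ne (le_potential x h u j) fun hj' => hj (key j hj')

lemma potential_eq_of_mem_cell [Nonempty (Fin n)] {Ω : Set (EuclideanSpace ℝ (Fin d))}
    (hx : Function.Injective x) {h : Fin n → ℝ} {i : Fin n} {u : EuclideanSpace ℝ (Fin d)}
    (hu : u ∈ cell Ω x h i) : inner ℝ u (x i) + h i = potential x h u := by
  obtain ⟨m, hm⟩ := exists_eq_potential x h u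
  obtain rfl := hx (eq_of_hasGradientAt_potential hu.2 hm)
  exact hm

lemma pairwise_disjoint_cell (hx : Function.Injective x) (Ω : Set (EuclideanSpace ℝ (Fin d)))
    (h : Fin n → ℝ) : Pairwise (Function.onFun Disjoint (cell Ω x h)) := fun _ _ hij =>
  Set.disjoint_left.2 fun _ hi hj => hij (hx (hi.2.unique hj.2))

lemma volume_hyperplane {v : EuclideanSpace ℝ (Fin d)} (hv : v ≠ 0) (c : ℝ) :
    volume {u : EuclideanSpace ℝ (Fin d) | inner ℝ u v = c} = 0 := by
  rcases Set.eq_empty_or_nonempty {u : EuclideanSpace ℝ (Fin d) | inner ℝ u v = c} with he | ⟨p, hp⟩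
  · rw [he, measure_empty]
  refine measure_mono_null (t := (AffineSubspace.mk' p (ℝ ∙ v)ᗮ : Set _)) (fun u hu => ?_)
    (Measure.addHaar_affineSubspace _ _ fun htop => hv ?_)
  · rw [SetLike.mem_coe, AffineSubspace.mem_mk', Submodule.mem_orthogonal_singleton_iff_inner_left,
      vsub_eq_sub, inner_sub_left, hu, hp, sub_self]
  · have : p + v ∈ AffineSubspace.mk' p (ℝ ∙ v)ᗮ := htop ▸ AffineSubspace.mem_top ℝ _ _
    rw [AffineSubspace.mem_mk', Submodule.mem_orthogonal_singleton_iff_inner_left] at this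
    simpa using this

lemma ae_exists_mem_cell [Nonempty (Fin n)]
    (hx : Function.Injective x) (Ω : Set (EuclideanSpace ℝ (Fin d)))
    (h : Fin n → ℝ) : ∀ᵐ u, u ∈ Ω → ∃ i, u ∈ cell Ω x h i := by
  have h1 : ∀ᵐ u : EuclideanSpace ℝ (Fin d), ∀ i j, i ≠ j →
      inner ℝ u (x j) + h j ≠ inner ℝ u (x i) + h i := by
    refine ae_all_iff.2 fun i => ae_all_iff.2 fun j => ?_
    by_cases hij : i = j
    · simp [hij]
    -- Ties between `i` and `j` lie on a hyperplane with normal `x i - x j ≠ 0`.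
    · have := volume_hyperplane (sub_ne_zero.2 fun he => hij (hx he)) (h j - h i)
      filter_upwards [compl_mem_ae_iff.2 this] with u hu _ he
      exact hu (by rw [mem_ofPred_eq, inner_sub_right]; linarith)
  filter_upwards [h1] with u hu huΩ
  obtain ⟨i, hi⟩ := exists_eq_potential x h u
  exact ⟨i, (mem_cell_iff hx).2 ⟨huΩ, fun j hj =>
    lt_of_le_of_ne (hi ▸ le_potential x h u j) (hu i j hj.symm)⟩⟩

lemma volume_diff_iUnion_cell [Nonempty (Fin n)]
    (hx : Function.Injective x) (Ω : Set (EuclideanSpace ℝ (Fin d)))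
    (h : Fin n → ℝ) : volume (Ω \ ⋃ i, cell Ω x h i) = 0 := by
  refine measure_mono_null (fun u hu => ?_) (ae_iff.1 (ae_exists_mem_cell hx Ω h))
  simpa using hu

/-- The inequalities that cut out a cell are affine in `(u, h)` jointly; this is what makes `H₀`
convex. -/
lemma combo_mem_cell [Nonempty (Fin n)]
    (hx : Function.Injective x) {Ω : Set (EuclideanSpace ℝ (Fin d))}
    (hΩ : Convex ℝ Ω) {h h' : Fin n → ℝ} {i : Fin n} {u v : EuclideanSpace ℝ (Fin d)}
    (hu : u ∈ cell Ω x h i) (hv : v ∈ cell Ω x h' i) {a b : ℝ} (ha : 0 ≤ a) (hb : 0 ≤ b)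
    (hab : a + b = 1) : a • u + b • v ∈ cell Ω x (a • h + b • h') i := by
  rw [mem_cell_iff hx] at hu hv ⊢
  refine ⟨hΩ hu.1 hv.1 ha hb hab, fun j hj => ?_⟩
  have h1 := hu.2 j hj
  have h2 := hv.2 j hj
  simp only [inner_add_left, real_inner_smul_left, Pi.add_apply, Pi.smul_apply, smul_eq_mul]
  rcases ha.eq_or_lt with rfl | ha
  · obtain rfl : b = 1 := by linarith
    linarith
  · nlinarith [mul_lt_mul_of_pos_left h1 ha, mul_le_mul_of_nonneg_left h2.le hb]

lemma convex_H₀ [Nonempty (Fin n)] (hx : Function.Injective x) {Ω : Set (EuclideanSpace ℝ (Fin d))}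
    (hΩ : Convex ℝ Ω) : Convex ℝ (H₀ Ω x) := by
  refine fun h hh h' hh' a b ha hb hab => ⟨fun i => ?_, ?_⟩
  · obtain ⟨u, hu⟩ := hh.1 i
    obtain ⟨v, hv⟩ := hh'.1 i
    exact ⟨_, combo_mem_cell hx hΩ hu hv ha hb hab⟩
  · simp [Finset.sum_add_distrib, ← Finset.mul_sum, hh.2, hh'.2]

lemma isOpen_strict_cell (x : Fin n → EuclideanSpace ℝ (Fin d)) (h : Fin n → ℝ) (i : Fin n) :
    IsOpen {u | ∀ j, j ≠ i → inner ℝ u (x j) + h j < inner ℝ u (x i) + h i} := by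
  simp only [ofPred_forall]
  exact isOpen_iInter_of_finite fun j => isOpen_iInter_of_finite fun _ =>
    isOpen_lt (by fun_prop) (by fun_prop)

lemma gradient_eq_of_mem_cell {Ω : Set (EuclideanSpace ℝ (Fin d))} {h : Fin n → ℝ} {i : Fin n}
    {u : EuclideanSpace ℝ (Fin d)} (hu : u ∈ cell Ω x h i) : ∇ (potential x h) u = x i :=
  hu.2.gradient

lemma measurable_gradient_potential (x : Fin n → EuclideanSpace ℝ (Fin d)) (h : Fin n → ℝ) :
    Measurable (∇ (potential x h)) :=
  (InnerProductSpace.toDual ℝ _).symm.continuous.measurable.comp (measurable_fderiv ℝ _)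

end Potential

/-! ### Integrability, convexity and the equality case for the energy -/

section Energy

variable {d n : ℕ} {x : Fin n → EuclideanSpace ℝ (Fin d)} {Ω : Set (EuclideanSpace ℝ (Fin d))}
  {μ : Measure (EuclideanSpace ℝ (Fin d))}

/-- The frontier of a convex set is Lebesgue null, so `μ` cannot charge the part of the closure
outside `Ω`. -/
lemma ae_mem_of_support_eq_closure (hΩ : Convex ℝ Ω) (hμ : μ ≪ volume)
    (hsupp : μ.support = closure Ω) : ∀ᵐ u ∂μ, u ∈ Ω := by
  have h1 : ∀ᵐ u ∂μ, u ∈ closure Ω := hsupp ▸ Measure.support_mem_ae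
  have h2 : ∀ᵐ u ∂μ, u ∉ frontier Ω := hμ.ae_le (compl_mem_ae_iff.2 (hΩ.addHaar_frontier volume))
  filter_upwards [h1, h2] with u hu hu'
  exact interior_subset (by_contra fun h => hu' ⟨hu, h⟩)

lemma interior_nonempty_of_volume_pos (hΩ : Convex ℝ Ω) (hvol : 0 < volume Ω) :
    (interior Ω).Nonempty := by
  by_contra h
  rw [not_nonempty_iff_eq_empty] at h
  refine hvol.ne' (measure_mono_null (fun u hu => ?_) (hΩ.addHaar_frontier volume))
  exact ⟨subset_closure hu, by simp [h]⟩

/-- Open sets meeting the interior of a set inside the support have positive measure. -/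
lemma measure_pos_of_mem_interior (hsupp : μ.support = closure Ω)
    {U : Set (EuclideanSpace ℝ (Fin d))} (hU : IsOpen U) {u : EuclideanSpace ℝ (Fin d)}
    (hu : u ∈ U) (hu' : u ∈ interior Ω) : 0 < μ U :=
  (Measure.mem_support_iff_forall u).1
    (hsupp ▸ subset_closure (interior_subset hu')) U (hU.mem_nhds hu)

lemma integrable_potential [Nonempty (Fin n)] [IsFiniteMeasure μ]
    (hmean : Integrable (fun u : EuclideanSpace ℝ (Fin d) => u) μ) (h : Fin n → ℝ) :
    Integrable (potential x h) μ := by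
  refine ((hmean.norm.const_mul (∑ i, ‖x i‖)).add (integrable_const (∑ i, |h i|))).mono'
    (continuous_potential x h).aestronglyMeasurable (Eventually.of_forall fun u => ?_)
  exact abs_potential_le h u

lemma energy_eq (hae : ∀ᵐ u ∂μ, u ∈ Ω) (h : Fin n → ℝ) :
    energy Ω μ x h = (∫ u, potential x h u ∂μ) - (1 / (n : ℝ)) * ∑ i, h i := by
  rw [energy, Measure.restrict_eq_self_of_ae_mem hae]

lemma energy_add_const [Nonempty (Fin n)] [IsProbabilityMeasure μ] (hae : ∀ᵐ u ∂μ, u ∈ Ω)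
    (hmean : Integrable (fun u : EuclideanSpace ℝ (Fin d) => u) μ) (h : Fin n → ℝ) (b : ℝ) :
    energy Ω μ x (fun i => h i + b) = energy Ω μ x h := by
  have hn : (n : ℝ) ≠ 0 := Nat.cast_ne_zero.2 (Fin.pos_iff_nonempty.2 ‹_›).ne'
  simp only [energy_eq hae, potential_add_const, Finset.sum_add_distrib, Finset.sum_const,
    Finset.card_univ, Fintype.card_fin, nsmul_eq_mul]
  rw [integral_add (integrable_potential hmean h) (integrable_const b)]
  simp only [integral_const, probReal_univ, one_smul]
  field_simp
  ring

lemma convexOn_energy [Nonempty (Fin n)] [IsProbabilityMeasure μ] (hae : ∀ᵐ u ∂μ, u ∈ Ω)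
    (hmean : Integrable (fun u : EuclideanSpace ℝ (Fin d) => u) μ) :
    ConvexOn ℝ univ (energy Ω μ x) := by
  refine ⟨convex_univ, fun h _ h' _ a b ha hb hab => ?_⟩
  have hi := integrable_potential (x := x) hmean
  have h1 := integral_mono (hi (a • h + b • h'))
    (((hi h).const_mul a).add ((hi h').const_mul b))
    fun u => potential_combo_le h h' u ha hb hab
  simp only [Pi.add_apply] at h1
  rw [integral_add ((hi h).const_mul a) ((hi h').const_mul b), integral_const_mul,
    integral_const_mul] at h1
  simp only [energy_eq hae, Pi.add_apply, Pi.smul_apply, smul_eq_mul, Finset.sum_add_distrib,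
    ← Finset.mul_sum] at h1 ⊢
  linarith

/-- Equality in the convexity inequality for the energy forces the two decompositions to
coincide almost everywhere. -/
lemma ae_common_cell_of_combo_le [Nonempty (Fin n)] [IsProbabilityMeasure μ]
    (hae : ∀ᵐ u ∂μ, u ∈ Ω) (hmean : Integrable (fun u : EuclideanSpace ℝ (Fin d) => u) μ)
    {h h' : Fin n → ℝ} {a b : ℝ} (ha : 0 < a) (hb : 0 < b) (hab : a + b = 1)
    (hle : a * energy Ω μ x h + b * energy Ω μ x h' ≤ energy Ω μ x (a • h + b • h')) :
    ∀ᵐ u ∂μ, ∃ i, inner ℝ u (x i) + h i = potential x h u ∧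
      inner ℝ u (x i) + h' i = potential x h' u := by
  have hi := integrable_potential (x := x) hmean
  have hint := ((hi h).const_mul a).add ((hi h').const_mul b)
  have hpt : ∀ u, potential x (a • h + b • h') u ≤ a * potential x h u + b * potential x h' u :=
    fun u => potential_combo_le h h' u ha.le hb.le hab
  have h1 : ∫ u, potential x (a • h + b • h') u ∂μ =
      ∫ u, a * potential x h u + b * potential x h' u ∂μ := by
    refine le_antisymm (integral_mono (hi _) hint hpt) ?_
    rw [integral_add ((hi h).const_mul a) ((hi h').const_mul b), integral_const_mul,
      integral_const_mul]
    simp only [energy_eq hae, Pi.add_apply, Pi.smul_apply, smul_eq_mul, Finset.sum_add_distrib,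
      ← Finset.mul_sum] at hle
    linarith
  filter_upwards [(integral_eq_iff_of_ae_le (hi _) hint (Eventually.of_forall hpt)).1 h1]
    with u hu
  exact exists_common_max_of_combo_eq ha hb hab hu

/-- If almost everywhere a common index is maximal for `h` and `h'`, and no cell of `h` is empty,
then `h` and `h'` differ by a constant. -/
lemma eq_add_const_of_ae_common_cell [Nonempty (Fin n)] (hx : Function.Injective x)
    (hΩ : Convex ℝ Ω) (hvol : 0 < volume Ω) (hsupp : μ.support = closure Ω) {h h' : Fin n → ℝ}
    (hne : ∀ i, (cell Ω x h i).Nonempty)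
    (hc : ∀ᵐ u ∂μ, ∃ i, inner ℝ u (x i) + h i = potential x h u ∧
      inner ℝ u (x i) + h' i = potential x h' u) :
    ∃ b : ℝ, h' = fun i => h i + b := by
  set g := fun u => potential x h' u - potential x h u with hg
  have hgc : Continuous g := (continuous_potential x h').sub (continuous_potential x h)
  have hfin : (range fun i => h' i - h i).Finite := finite_range _
  -- The property holds almost everywhere; it extends to every interior point because a violation
  -- would be open, hence of positive measure.
  have hmem : ∀ u ∈ interior Ω, g u ∈ range fun i => h' i - h i := by
    intro u hu
    by_contra hnot
    refine (measure_pos_of_mem_interior hsupp (hfin.isClosed.isOpen_compl.preimage hgc) hnot hu).ne'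
      (measure_mono_null (fun v hv => ?_) (ae_iff.1 hc))
    rintro ⟨i, hi, hi'⟩
    exact hv ⟨i, by simp only [hg]; linarith⟩
  obtain ⟨u₀, hu₀⟩ := interior_nonempty_of_volume_pos hΩ hvol
  refine ⟨g u₀, funext fun i => ?_⟩
  obtain ⟨u, hu⟩ := hne i
  rw [mem_cell_iff hx] at hu
  have hucl : u ∈ closure (interior Ω) := by
    rw [hΩ.closure_interior_eq_closure_of_nonempty_interior ⟨u₀, hu₀⟩]
    exact subset_closure hu.1
  -- The given point of the cell may lie on the frontier of `Ω`; the strict inequalities persist at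
  -- a nearby interior point.
  obtain ⟨v, hv, hvint⟩ := mem_closure_iff.1 hucl _ (isOpen_strict_cell x h i) hu.2
  have hpos := measure_pos_of_mem_interior hsupp
    ((isOpen_strict_cell x h i).inter isOpen_interior) ⟨hv, hvint⟩ hvint
  obtain ⟨w, ⟨hw, hwint⟩, j, hj, hj'⟩ :=
    ((frequently_ae_mem_iff.2 hpos.ne').and_eventually hc).exists
  obtain rfl : j = i := by
    by_contra hji
    linarith [hw j hji, le_potential x h w i]
  have := hΩ.interior.isPreconnected.constant_of_mapsTo hfin.isDiscrete hgc.continuousOn hmem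
    hu₀ hwint
  rw [this]
  simp only [hg]
  linarith

end Energy

/-! ### Transports, minimizers and optimality -/

section Transport

variable {d n : ℕ} {x : Fin n → EuclideanSpace ℝ (Fin d)} {Ω : Set (EuclideanSpace ℝ (Fin d))}
  {μ : Measure (EuclideanSpace ℝ (Fin d))}

lemma map_eq_sum_dirac {T : EuclideanSpace ℝ (Fin d) → EuclideanSpace ℝ (Fin d)}
    (hx : Function.Injective x) (hT : Measurable T) (hTx : ∀ᵐ u ∂μ, ∃ i, T u = x i) :
    μ.map T = ∑ i, μ (T ⁻¹' {x i}) • Measure.dirac (x i) := by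
  classical
  ext s hs
  have h1 : (T ⁻¹' s : Set _) =ᵐ[μ]
      (⋃ i ∈ Finset.univ.filter fun i => x i ∈ s, T ⁻¹' {x i} : Set _) := by
    filter_upwards [hTx] with u ⟨i, hi⟩
    refine propext ⟨fun hu => ?_, fun hu => ?_⟩
    · exact mem_biUnion (Finset.mem_coe.2 (Finset.mem_filter.2 ⟨Finset.mem_univ i, hi ▸ hu⟩)) hi
    · obtain ⟨j, hj, hj'⟩ := mem_iUnion₂.1 hu
      exact show T u ∈ s from (show T u = x j from hj') ▸ (Finset.mem_filter.1 hj).2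
  rw [Measure.map_apply hT hs, measure_congr h1, measure_biUnion_finset
    (fun i _ j _ hij => Disjoint.preimage T (by simpa using fun he => hij (hx he)))
    fun i _ => hT (measurableSet_singleton _), Finset.sum_filter]
  simp only [Measure.coe_finsetSum, Finset.sum_apply, Measure.smul_apply, smul_eq_mul,
    Measure.dirac_apply' _ hs, indicator_apply, Pi.one_apply, mul_ite, mul_one, mul_zero]

lemma empiricalMeasure_singleton (hx : Function.Injective x) (i : Fin n) :
    empiricalMeasure x {x i} = (n : ℝ≥0∞)⁻¹ := by
  classical
  simp [empiricalMeasure, indicator_apply, hx.eq_iff]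

lemma measurePreserving_empiricalMeasure_iff
    {T : EuclideanSpace ℝ (Fin d) → EuclideanSpace ℝ (Fin d)}
    (hx : Function.Injective x) (hT : Measurable T) (hTx : ∀ᵐ u ∂μ, ∃ i, T u = x i) :
    MeasurePreserving T μ (empiricalMeasure x) ↔ ∀ i, μ (T ⁻¹' {x i}) = (n : ℝ≥0∞)⁻¹ := by
  refine ⟨fun h i => ?_, fun h => ⟨hT, ?_⟩⟩
  · rw [h.measure_preimage (measurableSet_singleton _).nullMeasurableSet,
      empiricalMeasure_singleton hx]
  · rw [map_eq_sum_dirac hx hT hTx, empiricalMeasure, Finset.smul_sum]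
    simp only [h]

lemma ae_mem_range_of_measurePreserving
    {S : EuclideanSpace ℝ (Fin d) → EuclideanSpace ℝ (Fin d)}
    (hS : MeasurePreserving S μ (empiricalMeasure x)) : ∀ᵐ u ∂μ, ∃ i, S u = x i := by
  have h1 : ∀ᵐ y ∂(empiricalMeasure x), ∃ i, y = x i := by
    have hm : MeasurableSet (range x)ᶜ := (finite_range x).measurableSet.compl
    have : empiricalMeasure x (range x)ᶜ = 0 := by
      simp [empiricalMeasure, Measure.dirac_apply' _ hm]
    filter_upwards [compl_mem_ae_iff.2 this] with y hy
    rw [compl_compl] at hy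
    exact hy.imp fun _ => Eq.symm
  exact hS.quasiMeasurePreserving.ae h1

lemma sum_measureReal_preimage [IsProbabilityMeasure μ]
    {T : EuclideanSpace ℝ (Fin d) → EuclideanSpace ℝ (Fin d)}
    (hx : Function.Injective x) (hT : Measurable T) (hTx : ∀ᵐ u ∂μ, ∃ i, T u = x i) :
    ∑ i, μ.real (T ⁻¹' {x i}) = 1 := by
  have h1 := congrArg (fun ν : Measure (EuclideanSpace ℝ (Fin d)) => ν univ)
    (map_eq_sum_dirac hx hT hTx)
  simp only [Measure.map_apply hT MeasurableSet.univ, preimage_univ, measure_univ,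
    Measure.coe_finsetSum, Finset.sum_apply, Measure.smul_apply, smul_eq_mul, mul_one] at h1
  simp only [Measure.real]
  rw [← ENNReal.toReal_sum fun i _ => measure_ne_top _ _, ← h1, ENNReal.toReal_one]

lemma ae_exists_mem_cell_of_ac [Nonempty (Fin n)] (hx : Function.Injective x) (hμ : μ ≪ volume)
    (hae : ∀ᵐ u ∂μ, u ∈ Ω) (h : Fin n → ℝ) : ∀ᵐ u ∂μ, ∃ i, u ∈ cell Ω x h i := by
  filter_upwards [hae, hμ.ae_le (ae_exists_mem_cell hx Ω h)] with u hu hu' using hu' hu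

lemma ae_exists_gradient_eq [Nonempty (Fin n)] (hx : Function.Injective x) (hμ : μ ≪ volume)
    (hae : ∀ᵐ u ∂μ, u ∈ Ω) (h : Fin n → ℝ) : ∀ᵐ u ∂μ, ∃ i, ∇ (potential x h) u = x i := by
  filter_upwards [ae_exists_mem_cell_of_ac hx hμ hae h] with u ⟨i, hi⟩
  exact ⟨i, gradient_eq_of_mem_cell hi⟩

lemma isMonotoneTransport_gradient_iff [Nonempty (Fin n)] (hx : Function.Injective x)
    (hΩ : Convex ℝ Ω) (hμ : μ ≪ volume) (hae : ∀ᵐ u ∂μ, u ∈ Ω) (h : Fin n → ℝ) :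
    IsMonotoneTransport Ω μ (empiricalMeasure x) (∇ (potential x h)) ↔
      MeasurePreserving (∇ (potential x h)) μ (empiricalMeasure x) := by
  refine ⟨fun hT => hT.1, fun hT => ⟨hT, _, convexOn_potential x h hΩ, ?_⟩⟩
  filter_upwards [ae_exists_mem_cell_of_ac hx hμ hae h] with u ⟨i, hi⟩
  rw [gradient_eq_of_mem_cell hi]
  exact hi.2

lemma cell_nonempty_of_measurePreserving [Nonempty (Fin n)] (hx : Function.Injective x)
    (hμ : μ ≪ volume) (hae : ∀ᵐ u ∂μ, u ∈ Ω) {h : Fin n → ℝ}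
    (hT : MeasurePreserving (∇ (potential x h)) μ (empiricalMeasure x)) (i : Fin n) :
    (cell Ω x h i).Nonempty := by
  have h1 := (measurePreserving_empiricalMeasure_iff hx hT.measurable
    (ae_exists_gradient_eq hx hμ hae h)).1 hT i
  have h2 : μ (∇ (potential x h) ⁻¹' {x i}) ≠ 0 := by
    rw [h1]
    exact ENNReal.inv_ne_zero.2 (ENNReal.natCast_ne_top n)
  obtain ⟨u, hu, j, hj⟩ := ((frequently_ae_mem_iff.2 h2).and_eventually
    (ae_exists_mem_cell_of_ac hx hμ hae h)).exists
  obtain rfl : j = i := hx ((gradient_eq_of_mem_cell hj).symm.trans hu)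
  exact ⟨u, hj⟩

/-- A weight vector whose gradient is a transport minimizes the energy. -/
lemma isMinOn_energy_of_measurePreserving [Nonempty (Fin n)] [IsProbabilityMeasure μ]
    (hx : Function.Injective x) (hμ : μ ≪ volume) (hae : ∀ᵐ u ∂μ, u ∈ Ω)
    (hmean : Integrable (fun u : EuclideanSpace ℝ (Fin d) => u) μ) {h : Fin n → ℝ}
    (hT : MeasurePreserving (∇ (potential x h)) μ (empiricalMeasure x)) :
    IsMinOn (energy Ω μ x) univ h := by
  intro h' _
  have hmass := (measurePreserving_empiricalMeasure_iff hx hT.measurable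
    (ae_exists_gradient_eq hx hμ hae h)).1 hT
  have hi := integrable_potential (x := x) hmean
  have hms : ∀ i, MeasurableSet (∇ (potential x h) ⁻¹' {x i}) :=
    fun i => hT.measurable (measurableSet_singleton _)
  have hind : ∀ i, Integrable
      ((∇ (potential x h) ⁻¹' {x i}).indicator fun _ => h' i - h i) μ :=
    fun i => (integrable_const _).indicator (hms i)
  -- The integrated subgradient inequality: on the cell `j` the sum of indicators equals `h' j - h
  -- j`.
  have h1 : ∫ u, ∑ i, (∇ (potential x h) ⁻¹' {x i}).indicator (fun _ => h' i - h i) u ∂μ ≤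
      ∫ u, (potential x h' u - potential x h u) ∂μ := by
    refine integral_mono_ae (integrable_finsetSum _ fun i _ => hind i) ((hi h').sub (hi h)) ?_
    filter_upwards [ae_exists_mem_cell_of_ac hx hμ hae h] with u ⟨j, hj⟩
    have hgrad := gradient_eq_of_mem_cell hj
    rw [Finset.sum_eq_single j]
    · rw [indicator_of_mem (show u ∈ ∇ (potential x h) ⁻¹' {x j} from hgrad)]
      linarith [le_potential x h' u j, potential_eq_of_mem_cell hx hj]
    · intro i _ hij
      refine indicator_of_notMem (s := ∇ (potential x h) ⁻¹' {x i}) (fun hu => hij (hx ?_)) _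
      exact (show ∇ (potential x h) u = x i from hu).symm.trans hgrad
    · simp
  rw [integral_finsetSum _ fun i _ => hind i, integral_sub (hi h') (hi h)] at h1
  simp only [integral_indicator_const _ (hms _), Measure.real, hmass, ENNReal.toReal_inv,
    ENNReal.toReal_natCast, smul_eq_mul, ← Finset.mul_sum, Finset.sum_sub_distrib] at h1
  simp only [mem_ofPred_eq, energy_eq hae, one_div]
  linarith

/-- Raising one weight can only decrease the energy if the set where the corresponding affine
function is almost maximal carries too little mass. -/
lemma inv_le_measureReal_of_isMinOn [Nonempty (Fin n)] [IsProbabilityMeasure μ]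
    (hae : ∀ᵐ u ∂μ, u ∈ Ω) (hmean : Integrable (fun u : EuclideanSpace ℝ (Fin d) => u) μ)
    {h : Fin n → ℝ} (hmin : IsMinOn (energy Ω μ x) univ h) (i : Fin n) {t : ℝ} (ht : 0 < t) :
    1 / (n : ℝ) ≤ μ.real {u | potential x h u ≤ inner ℝ u (x i) + h i + t} := by
  set A := {u | potential x h u ≤ inner ℝ u (x i) + h i + t}
  have hA : MeasurableSet A := (isClosed_le (continuous_potential x h) (by fun_prop)).measurableSet
  have hi := integrable_potential (x := x) hmean
  set h' := Function.update h i (h i + t)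
  -- Off `A` the raised affine function still lies below `φ_h`; on `A` it exceeds `φ_h` by at most
  -- `t`.
  have hpt : ∀ u, potential x h' u ≤ potential x h u + A.indicator (fun _ => t) u := by
    intro u
    refine potential_le fun j => ?_
    have hnonneg : 0 ≤ A.indicator (fun _ => t) u := indicator_nonneg (fun _ _ => ht.le) u
    by_cases hj : j = i
    · subst hj
      simp only [h', Function.update_self]
      by_cases hu : u ∈ A
      · rw [indicator_of_mem hu]
        linarith [le_potential x h u j]
      · have : inner ℝ u (x j) + h j + t < potential x h u := not_le.1 hu
        linarith
    · simp only [h', Function.update_of_ne hj]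
      linarith [le_potential x h u j]
  have hind : Integrable (A.indicator fun _ => t) μ := (integrable_const t).indicator hA
  have h1 := integral_mono (hi h') ((hi h).add hind) hpt
  simp only [Pi.add_apply] at h1
  rw [integral_add (hi h) hind, integral_indicator_const _ hA, smul_eq_mul] at h1
  have h2 : energy Ω μ x h ≤ energy Ω μ x h' := hmin (mem_univ h')
  rw [energy_eq hae, energy_eq hae] at h2
  have h3 : ∑ j, h' j = ∑ j, h j + t := by
    rw [Finset.sum_update_of_mem (Finset.mem_univ i),
      ← Finset.add_sum_erase _ h (Finset.mem_univ i), Finset.sdiff_singleton_eq_erase]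
    ring
  rw [h3] at h2
  refine le_of_mul_le_mul_right ?_ ht
  linarith

/-- The gradient of the potential of a minimizer of the energy is a transport. -/
lemma measurePreserving_of_isMinOn_energy [Nonempty (Fin n)] [IsProbabilityMeasure μ]
    (hx : Function.Injective x) (hμ : μ ≪ volume) (hae : ∀ᵐ u ∂μ, u ∈ Ω)
    (hmean : Integrable (fun u : EuclideanSpace ℝ (Fin d) => u) μ) {h : Fin n → ℝ}
    (hmin : IsMinOn (energy Ω μ x) univ h) :
    MeasurePreserving (∇ (potential x h)) μ (empiricalMeasure x) := by
  have hm := measurable_gradient_potential x h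
  have hr := ae_exists_gradient_eq hx hμ hae h
  have hn : (n : ℝ) ≠ 0 := Nat.cast_ne_zero.2 (Fin.pos_iff_nonempty.2 ‹_›).ne'
  have hle : ∀ i, 1 / (n : ℝ) ≤ μ.real (∇ (potential x h) ⁻¹' {x i}) := by
    intro i
    -- The almost-maximal sets for `t = 1/(m+1)` decrease to the set where `i` is maximal, which is
    -- almost everywhere the fibre over `x i`.
    set s : ℕ → Set (EuclideanSpace ℝ (Fin d)) :=
      fun m => {u | potential x h u ≤ inner ℝ u (x i) + h i + 1 / ((m : ℝ) + 1)}
    have hs : ∀ m, NullMeasurableSet (s m) μ := fun m =>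
      (isClosed_le (continuous_potential x h) (by fun_prop)).measurableSet.nullMeasurableSet
    have hanti : Antitone s := fun m m' hmm' u hu => by
      have hu' : potential x h u ≤ inner ℝ u (x i) + h i + 1 / ((m' : ℝ) + 1) := hu
      exact hu'.trans (by gcongr)
    have hlim := tendsto_measure_iInter_atTop hs hanti ⟨0, measure_ne_top _ _⟩
    have hlim' := (ENNReal.tendsto_toReal (measure_ne_top μ _)).comp hlim
    refine (ge_of_tendsto' hlim' fun m =>
      inv_le_measureReal_of_isMinOn hae hmean hmin i Nat.one_div_pos_of_nat).trans_eq ?_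
    refine congrArg ENNReal.toReal (measure_congr ?_)
    filter_upwards [ae_exists_mem_cell_of_ac hx hμ hae h] with u ⟨j, hj⟩
    refine propext ⟨fun hu => ?_, fun hu => mem_iInter.2 fun m => ?_⟩
    · have hu' : potential x h u ≤ inner ℝ u (x i) + h i + 0 :=
        ge_of_tendsto' (tendsto_one_div_add_atTop_nhds_zero_nat.const_add _)
          fun m => mem_iInter.1 hu m
      obtain rfl : i = j := by
        by_contra hij
        linarith [((mem_cell_iff hx).1 hj).2 i hij, le_potential x h u j]
      exact gradient_eq_of_mem_cell hj
    · obtain rfl : j = i := hx ((gradient_eq_of_mem_cell hj).symm.trans hu)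
      have := potential_eq_of_mem_cell hx hj
      have h0 : (0 : ℝ) < 1 / ((m : ℝ) + 1) := Nat.one_div_pos_of_nat
      exact show potential x h u ≤ _ by linarith
  -- Both sides equal 1, so none of the inequalities `hle` can be strict.
  have hsum : ∑ _i : Fin n, 1 / (n : ℝ) = ∑ i, μ.real (∇ (potential x h) ⁻¹' {x i}) := by
    rw [sum_measureReal_preimage hx hm hr]
    simp [hn]
  have heq := (Finset.sum_eq_sum_iff_of_le fun i _ => hle i).1 hsum
  refine (measurePreserving_empiricalMeasure_iff hx hm hr).2 fun i => ?_
  rw [← ENNReal.toReal_eq_toReal_iff' (measure_ne_top _ _) (by simpa using hn)]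
  simpa [Measure.real] using (heq i (Finset.mem_univ i)).symm

lemma exists_isMinOn_energy [Nonempty (Fin n)] [IsProbabilityMeasure μ]
    (hae : ∀ᵐ u ∂μ, u ∈ Ω) (hmean : Integrable (fun u : EuclideanSpace ℝ (Fin d) => u) μ) :
    ∃ h, IsMinOn (energy Ω μ x) univ h := by
  have hn : (n : ℝ) ≠ 0 := Nat.cast_ne_zero.2 (Fin.pos_iff_nonempty.2 ‹_›).ne'
  have hi := integrable_potential (x := x) hmean
  have hcont : Continuous (energy Ω μ x) :=
    continuousOn_univ.1 ((convexOn_energy hae hmean).continuousOn isOpen_univ)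
  -- Integrating `h i - (∑ ‖x i‖) ‖u‖ ≤ φ_h(u)` bounds each weight above by the energy plus a
  -- constant; `B` is this bound on the sublevel set of `h = 0`.
  set B := energy Ω μ x 0 + (∑ i, ‖x i‖) * ∫ u, ‖u‖ ∂μ with hB
  have hbound : ∀ h : Fin n → ℝ, ∑ i, h i = 0 → ∀ i,
      h i ≤ energy Ω μ x h + (∑ i, ‖x i‖) * ∫ u, ‖u‖ ∂μ := by
    intro h hsum i
    have h1 := integral_mono ((integrable_const (h i)).sub (hmean.norm.const_mul (∑ i, ‖x i‖)))
      (hi h) (fun u => by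
        have h1 := le_potential x h u i
        have h2 := neg_le_of_abs_le (abs_real_inner_le_norm u (x i))
        have h3 : ‖x i‖ ≤ ∑ i, ‖x i‖ :=
          Finset.single_le_sum (f := fun i => ‖x i‖) (fun _ _ => norm_nonneg _) (Finset.mem_univ i)
        have h4 := mul_le_mul_of_nonneg_right h3 (norm_nonneg u)
        show h i - (∑ i, ‖x i‖) * ‖u‖ ≤ _
        linarith)
    simp only [Pi.sub_apply] at h1
    rw [integral_sub (integrable_const _) (hmean.norm.const_mul _), integral_const_mul] at h1
    simp only [integral_const, probReal_univ, one_smul] at h1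
    rw [energy_eq hae, hsum]
    linarith
  -- With zero sum, the upper bound `B` on the other weights gives a lower bound on each; `-(n * B)`
  -- suffices because `B ≥ 0`.
  set K : Set (Fin n → ℝ) := {h | ∑ i, h i = 0} ∩ Icc (fun _ => -(n * B)) (fun _ => B) with hK
  have hKc : IsCompact K :=
    isCompact_Icc.inter_left (isClosed_eq (by fun_prop) continuous_const)
  have hmemK : ∀ h : Fin n → ℝ, ∑ i, h i = 0 → energy Ω μ x h ≤ energy Ω μ x 0 → h ∈ K := by
    intro h hsum hle
    have hub : ∀ i, h i ≤ B := fun i => (hbound h hsum i).trans (by linarith)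
    have hB0 : 0 ≤ B := hbound 0 (by simp) (Classical.arbitrary _)
    refine ⟨hsum, fun i => ?_, hub⟩
    have h1 : ∑ j ∈ Finset.univ.erase i, h j ≤ n * B := by
      calc ∑ j ∈ Finset.univ.erase i, h j ≤ ∑ j ∈ Finset.univ.erase i, B :=
            Finset.sum_le_sum fun j _ => hub j
        _ ≤ ∑ _j : Fin n, B :=
            Finset.sum_le_sum_of_subset_of_nonneg (Finset.erase_subset _ _) fun _ _ _ => hB0
        _ = n * B := by simp
    have h2 := Finset.add_sum_erase _ h (Finset.mem_univ i)
    show -(n * B) ≤ h i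
    linarith
  have h0K : (0 : Fin n → ℝ) ∈ K := hmemK 0 (by simp) le_rfl
  obtain ⟨hs, -, hmin⟩ := hKc.exists_isMinOn ⟨0, h0K⟩ hcont.continuousOn
  refine ⟨hs, fun h _ => ?_⟩
  -- Subtracting the mean moves `h` to the zero-sum hyperplane without changing its energy.
  set c := (1 / (n : ℝ)) * ∑ i, h i with hc
  show energy Ω μ x hs ≤ energy Ω μ x h
  rw [← energy_add_const hae hmean h (-c)]
  rcases le_total (energy Ω μ x fun i => h i + -c) (energy Ω μ x 0) with hle | hle
  · refine hmin (hmemK _ ?_ hle)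
    simp only [Finset.sum_add_distrib, Finset.sum_const, Finset.card_univ, Fintype.card_fin,
      nsmul_eq_mul, hc]
    field_simp
    ring
  · exact (hmin h0K).trans hle

/-- Any two minimizers of the energy differ by a constant. -/
lemma eq_add_const_of_isMinOn_energy [Nonempty (Fin n)] [IsProbabilityMeasure μ]
    (hx : Function.Injective x) (hΩ : Convex ℝ Ω) (hvol : 0 < volume Ω) (hμ : μ ≪ volume)
    (hsupp : μ.support = closure Ω)
    (hmean : Integrable (fun u : EuclideanSpace ℝ (Fin d) => u) μ) {h h' : Fin n → ℝ}
    (hmin : IsMinOn (energy Ω μ x) univ h) (hmin' : IsMinOn (energy Ω μ x) univ h') :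
    ∃ b : ℝ, h' = fun i => h i + b := by
  have hae := ae_mem_of_support_eq_closure hΩ hμ hsupp
  refine eq_add_const_of_ae_common_cell hx hΩ hvol hsupp (cell_nonempty_of_measurePreserving hx hμ
    hae (measurePreserving_of_isMinOn_energy hx hμ hae hmean hmin))
    (ae_common_cell_of_combo_le hae hmean (a := 1 / 2) (b := 1 / 2) (by norm_num) (by norm_num)
      (by norm_num) ?_)
  have h1 : energy Ω μ x h ≤ energy Ω μ x ((1 / 2 : ℝ) • h + (1 / 2 : ℝ) • h') :=
    hmin (mem_univ _)
  have h2 : energy Ω μ x h' ≤ energy Ω μ x ((1 / 2 : ℝ) • h + (1 / 2 : ℝ) • h') :=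
    hmin' (mem_univ _)
  linarith

/-- Failure of strictness makes the two weights differ by a constant, and the zero-sum normalization
forces this constant to vanish. -/
lemma strictConvexOn_energy [Nonempty (Fin n)] [IsProbabilityMeasure μ]
    (hx : Function.Injective x) (hΩ : Convex ℝ Ω) (hvol : 0 < volume Ω) (hμ : μ ≪ volume)
    (hsupp : μ.support = closure Ω)
    (hmean : Integrable (fun u : EuclideanSpace ℝ (Fin d) => u) μ) :
    StrictConvexOn ℝ (H₀ Ω x) (energy Ω μ x) := by
  have hae := ae_mem_of_support_eq_closure hΩ hμ hsupp
  refine ⟨convex_H₀ hx hΩ, fun h hh h' hh' hne a b ha hb hab => ?_⟩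
  by_contra hlt
  rw [not_lt, smul_eq_mul, smul_eq_mul] at hlt
  obtain ⟨c, rfl⟩ := eq_add_const_of_ae_common_cell hx hΩ hvol hsupp hh.1
    (ae_common_cell_of_combo_le hae hmean ha hb hab hlt)
  have hn : (n : ℝ) ≠ 0 := Nat.cast_ne_zero.2 (Fin.pos_iff_nonempty.2 ‹_›).ne'
  have h1 := hh'.2
  rw [Finset.sum_add_distrib, hh.2] at h1
  have hc : c = 0 := by simpa [hn] using h1
  exact hne (by simp [hc])

/-- On a cell, `x i` minimizes `‖u - x j‖² - q j` over all `j`. The correction depends only on the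
target point, so all transports share its integral. -/
lemma isQuadraticOptimal_gradient [Nonempty (Fin n)] (hx : Function.Injective x)
    (hμ : μ ≪ volume) (hae : ∀ᵐ u ∂μ, u ∈ Ω) [IsProbabilityMeasure μ] {h : Fin n → ℝ}
    (hT : MeasurePreserving (∇ (potential x h)) μ (empiricalMeasure x)) :
    IsQuadraticOptimal μ (empiricalMeasure x) (∇ (potential x h)) := by
  classical
  refine ⟨hT, fun S hS => ?_⟩
  set q : Fin n → ℝ := fun i => ‖x i‖ ^ 2 + 2 * h i with hq
  -- The shift by `C` keeps the correction nonnegative, so that the comparison can be made in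
  -- `ℝ≥0∞`, where the cost may be infinite.
  set C := ∑ i, |q i|
  have hC : ∀ i, 0 ≤ C - q i := fun i => sub_nonneg.2 <| (le_abs_self _).trans
    (Finset.single_le_sum (f := fun i => |q i|) (fun _ _ => abs_nonneg _) (Finset.mem_univ i))
  set F : EuclideanSpace ℝ (Fin d) → ℝ≥0∞ :=
    fun y => ∑ i, ({x i} : Set _).indicator (fun _ => ENNReal.ofReal (C - q i)) y with hF
  have hFx : ∀ i, F (x i) = ENNReal.ofReal (C - q i) := by
    intro i
    simp only [hF, indicator_apply, mem_singleton_iff, hx.eq_iff]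
    simp
  have hFm : Measurable F := Finset.measurable_fun_sum _ fun i _ =>
    measurable_const.indicator (measurableSet_singleton _)
  have hle : ∫⁻ u, (ENNReal.ofReal (‖u - ∇ (potential x h) u‖ ^ 2) + F (∇ (potential x h) u)) ∂μ ≤
      ∫⁻ u, (ENNReal.ofReal (‖u - S u‖ ^ 2) + F (S u)) ∂μ := by
    refine lintegral_mono_ae ?_
    filter_upwards [ae_exists_mem_cell_of_ac hx hμ hae h, ae_mem_range_of_measurePreserving hS]
      with u ⟨i, hi⟩ ⟨j, hj⟩
    rw [gradient_eq_of_mem_cell hi, hj, hFx, hFx, ← ENNReal.ofReal_add (sq_nonneg _) (hC i),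
      ← ENNReal.ofReal_add (sq_nonneg _) (hC j)]
    refine ENNReal.ofReal_le_ofReal ?_
    rw [norm_sub_sq_real, norm_sub_sq_real]
    have h1 := potential_eq_of_mem_cell hx hi
    have h2 := le_potential x h u j
    simp only [hq]
    linarith
  rw [lintegral_add_right _ (by exact hFm.comp hT.measurable),
    lintegral_add_right _ (by exact hFm.comp hS.measurable),
    hT.lintegral_comp hFm, hS.lintegral_comp hFm] at hle
  -- Only the correction must be finite for the cancellation; no second moment of `μ` is needed.
  refine (ENNReal.add_le_add_iff_right ?_).1 hle
  rw [← hT.lintegral_comp hFm]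
  refine ne_top_of_le_ne_top (b := ∑ i, ENNReal.ofReal (C - q i)) (by simp) ?_
  calc ∫⁻ u, F (∇ (potential x h) u) ∂μ ≤ ∫⁻ _, ∑ i, ENNReal.ofReal (C - q i) ∂μ :=
        lintegral_mono fun u => Finset.sum_le_sum fun i _ => indicator_le_self' (by simp) _
    _ = _ := by simp

end Transport

end DiscreteTransport

theorem mainTheorem5 {d n : ℕ} (hn : 1 ≤ n)
    (x : Fin n → EuclideanSpace ℝ (Fin d)) (hx : Function.Injective x)
    (Ω : Set (EuclideanSpace ℝ (Fin d))) (hΩ : Convex ℝ Ω) (hvol : 0 < volume Ω)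
    (μ : Measure (EuclideanSpace ℝ (Fin d))) [IsProbabilityMeasure μ]
    (hμ : μ ≪ volume) (hsupp : μ.support = closure Ω)
    (hmean : Integrable (fun u : EuclideanSpace ℝ (Fin d) => u) μ) :
    -- for every `h`, the gradient of the potential is piecewise constant: up to a null set, `Ω` is
    -- the disjoint union of the cells (where the gradient is `x i`), and these are polyhedral
    (∀ h : Fin n → ℝ,
      (∀ i, DiscreteTransport.cell Ω x h i =
        {u | u ∈ Ω ∧ ∀ j, j ≠ i → inner ℝ u (x j) + h j < inner ℝ u (x i) + h i}) ∧
      Pairwise (Function.onFun Disjoint (DiscreteTransport.cell Ω x h)) ∧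
      volume (Ω \ ⋃ i, DiscreteTransport.cell Ω x h i) = 0) ∧
    -- the energy is well defined
    (∀ h : Fin n → ℝ, IntegrableOn (DiscreteTransport.potential x h) Ω μ) ∧
    (∃ hstar : Fin n → ℝ,
      -- the gradient for `hstar` is a monotone transport, and is optimal for the quadratic cost
      DiscreteTransport.IsMonotoneTransport Ω μ (DiscreteTransport.empiricalMeasure x)
        (∇ (DiscreteTransport.potential x hstar)) ∧
      DiscreteTransport.IsQuadraticOptimal μ (DiscreteTransport.empiricalMeasure x)
        (∇ (DiscreteTransport.potential x hstar)) ∧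
      -- `hstar` minimizes the energy
      IsMinOn (DiscreteTransport.energy Ω μ x) univ hstar ∧
      -- and is unique up to a constant, as a minimizer and as a transport potential
      (∀ h : Fin n → ℝ, IsMinOn (DiscreteTransport.energy Ω μ x) univ h ↔
        ∃ b : ℝ, h = fun i => hstar i + b) ∧
      (∀ h : Fin n → ℝ,
        DiscreteTransport.IsMonotoneTransport Ω μ (DiscreteTransport.empiricalMeasure x)
          (∇ (DiscreteTransport.potential x h)) ↔
        ∃ b : ℝ, h = fun i => hstar i + b)) ∧
    StrictConvexOn ℝ (DiscreteTransport.H₀ Ω x) (DiscreteTransport.energy Ω μ x) := by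
  have : Nonempty (Fin n) := Fin.pos_iff_nonempty.1 hn
  have hae := DiscreteTransport.ae_mem_of_support_eq_closure hΩ hμ hsupp
  obtain ⟨hs, hmin⟩ := DiscreteTransport.exists_isMinOn_energy (x := x) hae hmean
  have hT := DiscreteTransport.measurePreserving_of_isMinOn_energy hx hμ hae hmean hmin
  have huniq : ∀ h : Fin n → ℝ, IsMinOn (DiscreteTransport.energy Ω μ x) univ h ↔
      ∃ b : ℝ, h = fun i => hs i + b := by
    refine fun h => ⟨DiscreteTransport.eq_add_const_of_isMinOn_energy hx hΩ hvol hμ hsupp hmean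
      hmin, ?_⟩
    rintro ⟨b, rfl⟩ h' hh'
    rw [mem_ofPred_eq, DiscreteTransport.energy_add_const hae hmean]
    exact hmin hh'
  refine ⟨fun h => ⟨fun i => Set.ext fun u => DiscreteTransport.mem_cell_iff hx,
    DiscreteTransport.pairwise_disjoint_cell hx Ω h,
    DiscreteTransport.volume_diff_iUnion_cell hx Ω h⟩,
    fun h => (DiscreteTransport.integrable_potential hmean h).integrableOn,
    ⟨hs, (DiscreteTransport.isMonotoneTransport_gradient_iff hx hΩ hμ hae hs).2 hT,
      DiscreteTransport.isQuadraticOptimal_gradient hx hμ hae hT, hmin, huniq, fun h => ?_⟩,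
    DiscreteTransport.strictConvexOn_energy hx hΩ hvol hμ hsupp hmean⟩
  rw [← huniq h, DiscreteTransport.isMonotoneTransport_gradient_iff hx hΩ hμ hae h]
  exact ⟨DiscreteTransport.isMinOn_energy_of_measurePreserving hx hμ hae hmean,
    DiscreteTransport.measurePreserving_of_isMinOn_energy hx hμ hae hmean⟩
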